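/- Let $C$ be a smooth projective curve over $\mathbb{C}$ (equivalently, a compact connected Riemann surface) with canonical bundle $K_C$, and let $E\to C$ be a vector bundle of rank $r$. For $\xi\in H^0(C,K_C)^*$ let $$\Lambda(\xi)\colon H^0(C,E)\to H^0(C,K_C\otimes E^*)^*\ (\cong H^1(C,E)),\qquad \Lambda(\xi)(s)(t)=\xi\big(\bar\mu(s\otimes t)\big),$$ where $\bar\mu\colon H^0(C,E)\otimes H^0(C,K_C\otimes E^*)\to H^0(C,K_C)$ is the Petri trace map (multiplication followed by the trace $K_C\otimes\mathrm{End}\,E\to K_C$); thus $\Lambda$ is the matrix of linear forms $(\bar\mu(s_i\otimes t_j))$ on $H^0(C,K_C)^*\cong H^1(C,\mathcal{O}_C)$. For $p\in C$ and $0\ne v\in T_pC$ let $\varphi_{p,v}\in H^0(C,K_C)^*$ be the functional $\omega\mapsto\omega_p(v)$, which represents the image $\varphi(p)$ of $p$ under the canonical map $\varphi\colon C\to|K_C|^*=\mathbb{P}(H^0(C,K_C)^*)$. Let $\Theta_E=\{L\in\mathrm{Pic}^0(C): h^0(C,E\otimes L)\ge 1\}$. Identify a neighbourhood of $\mathcal{O}_C$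 in $\mathrm{Pic}^0(C)=H^0(C,K_C)^*/H_1(C,\mathbb{Z})$ (Abel--Jacobi) with a neighbourhood of $0$ in $H^0(C,K_C)^*$, and let $\mathcal{T}_{\mathcal{O}_C}(\Theta_E)$ be the tangent cone to $\Theta_E$ at $\mathcal{O}_C$: the common zero set in $H^0(C,K_C)^*$ (or in $\mathbb{P}(H^0(C,K_C)^*)$) of the leading forms at $0$ of all holomorphic function germs vanishing on $\Theta_E$. (If $\Theta_E$ is a divisor with local equation $f=f_n+f_{n+1}+\cdots$, $f_n\neq0$, this is the hypersurface $f_n=0$.) Suppose that $h^0(C,E)=r+1$ and that both $E$ and $K_C\otimes E^*$ are globally generated. Then $\Lambda|_C=\varphi^*\Lambda$ has constant rank $r$: for every $p\in C$ and $0\ne v\in T_pC$, the linear map $\Lambda(\varphi_{p,v})$ has rank $r$. In particular, the canonical curve lies in the tangent cone: $\varphi(p)\in\mathcal{T}_{\mathcal{O}_C}(\Theta_E)$ for every $p\in C$. -/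

import Mathlib

open scoped Manifold ContDiff Bundle Topology

noncomputable section

namespace CurveBundle

/-! ### Holomorphic vector bundles on a Riemann surface and their global sections

A smooth projective curve over `ℂ` is a compact connected Riemann surface `X`, i.e. an analytic
manifold modelled on `ℂ`.  A holomorphic vector bundle is a vector bundle over `X` with complex
fibres and analytic transition functions. -/

section Bundles

variable (X : Type*) [TopologicalSpace X] [ChartedSpace ℂ X]

/-- The fibre at `x` of the canonical bundle `K`: the cotangent space `Hom(T_x X, ℂ)`. -/
abbrev Canonical (x : X) : Type :=
  TangentSpace 𝓘(ℂ) x →L[ℂ] Bundle.Trivial X ℂ x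

instance (x : X) : IsTopologicalAddGroup (Canonical X x) :=
  ContinuousLinearMap.topologicalAddGroup

instance (x : X) : ContinuousSMul ℂ (Canonical X x) :=
  ContinuousLinearMap.continuousSMul

instance (x : X) : ContinuousAdd (Canonical X x) :=
  IsTopologicalAddGroup.toContinuousAdd

variable {X}
variable (F : Type*) [NormedAddCommGroup F] [NormedSpace ℂ F]
variable (E : X → Type*) [TopologicalSpace (Bundle.TotalSpace F E)]
  [∀ x, AddCommGroup (E x)] [∀ x, Module ℂ (E x)] [∀ x, TopologicalSpace (E x)]
  [FiberBundle F E] [VectorBundle ℂ F E]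

/-- `H⁰(X, E)`: the complex vector space of global holomorphic sections of `E`. -/
abbrev H0 : Type _ := ContMDiffSection 𝓘(ℂ) F ω E

/-- `E` is globally generated: global sections span (hence fill) every fibre. -/
def IsGloballyGenerated : Prop :=
  ∀ x : X, Function.Surjective fun s : H0 F E => s x

variable [IsManifold 𝓘(ℂ) ω X]

/-- The fibre at `x` of `K ⊗ E^*`, realised as the bundle `Hom(E, K)`. -/
abbrev SerreDual (x : X) : Type _ := E x →L[ℂ] Canonical X x

variable (X) in
/-- `H⁰(X, K)`: the space of holomorphic differentials. -/
abbrev H0K : Type _ := H0 (ℂ →L[ℂ] ℂ) (Canonical X)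

/-- `H⁰(X, K ⊗ E^*)`. -/
abbrev H0SerreDual : Type _ := H0 (F →L[ℂ] ℂ →L[ℂ] ℂ) (SerreDual E)

variable {F E}

/-- The contraction `⟨s, t⟩ ∈ H⁰(X, K)` of `s ∈ H⁰(X, E)` and `t ∈ H⁰(X, K ⊗ E^*)`; it is the
trace of the product section `s ⊗ t` of `K ⊗ End E`. -/
def contract (s : H0 F E) (t : H0SerreDual F E) : H0K X :=
  ⟨fun x => t x (s x), ContMDiff.clm_bundle_apply t.contMDiff s.contMDiff⟩

variable (F E)

/-- The Petri trace map `H⁰(X, E) ⊗ H⁰(X, K ⊗ E^*) → H⁰(X, K)`, as a bilinear map. -/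
def petriTrace : H0 F E →ₗ[ℂ] H0SerreDual F E →ₗ[ℂ] H0K X :=
  LinearMap.mk₂ ℂ contract
    (fun s s' t => by ext x : 1; exact map_add (t x) (s x) (s' x))
    (fun c s t => by ext x : 1; exact map_smul (t x) c (s x))
    (fun s t t' => by ext x : 1; rfl)
    (fun c s t => by ext x : 1; rfl)

/-- The matrix `Λ = (μ̄(s_i ⊗ t_j))` of linear forms on `H⁰(X, K)^*` (the canonical space), written
without bases: at a point `ξ` of `H⁰(X, K)^*` it is the linear map
`H⁰(X, E) → H⁰(X, K ⊗ E^*)^*`, `s ↦ (t ↦ ξ (μ̄(s ⊗ t)))`. -/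
def Lam (ξ : Module.Dual ℂ (H0K X)) :
    H0 F E →ₗ[ℂ] Module.Dual ℂ (H0SerreDual F E) :=
  (LinearMap.llcomp ℂ _ _ _ ξ).comp (petriTrace F E)

end Bundles

section Curve

variable {X : Type*} [TopologicalSpace X] [ChartedSpace ℂ X] [IsManifold 𝓘(ℂ) ω X]

/-- A representative in `H⁰(X, K)^*` of the image of `p` under the canonical map
`X → |K|^* = ℙ(H⁰(X, K)^*)`: evaluation of differentials at `p`, on a tangent vector `v` at `p`
(all nonzero `v` give the same point of the projective space). -/
def canonicalPoint (p : X) (v : TangentSpace 𝓘(ℂ) p) : Module.Dual ℂ (H0K X) where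
  toFun α := α p v
  map_add' _ _ := rfl
  map_smul' _ _ := rfl

/-- The velocity at time `t` of a path in the Riemann surface `X`. -/
def velocity (γ : ℝ → X) (t : ℝ) : TangentSpace 𝓘(ℂ) (γ t) :=
  (mfderiv 𝓘(ℝ) 𝓘(ℝ, ℂ) γ t (1 : ℝ) : ℂ)

/-- `∫_γ α`, for a differentiable path `γ` running from `γ 0` to `γ 1`. -/
def pathIntegral (γ : ℝ → X) (α : H0K X) : ℂ :=
  ∫ t in (0 : ℝ)..1, (α (γ t) (velocity γ t) : ℂ)

/-- The boundary `∑ (γ_i(1) - γ_i(0))` of a finite family of paths: a divisor of degree zero. -/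
def boundary {m : ℕ} (γ : Fin m → ℝ → X) : X →₀ ℤ :=
  ∑ i, (Finsupp.single (γ i 1) 1 - Finsupp.single (γ i 0) 1)

variable (F : Type*) [NormedAddCommGroup F] [NormedSpace ℂ F]
variable (E : X → Type*) [TopologicalSpace (Bundle.TotalSpace F E)]
  [∀ x, AddCommGroup (E x)] [∀ x, Module ℂ (E x)] [∀ x, TopologicalSpace (E x)]
  [FiberBundle F E] [VectorBundle ℂ F E]

/-- A (possibly singular) section of `E` near `x`, read in the preferred chart of `X` and the
preferred trivialization of `E` at `x`. -/
def localRep (s : ∀ x, E x) (x : X) : ℂ → F := fun z =>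
  (trivializationAt F E x ⟨(chartAt ℂ x).symm z, s ((chartAt ℂ x).symm z)⟩).2

/-- The order at `x` of a meromorphic section of `E` (`⊤` if it vanishes identically near `x`). -/
def sectionOrder (s : ∀ x, E x) (x : X) : WithTop ℤ :=
  meromorphicOrderAt (localRep F E s x) (chartAt ℂ x x)

/-- `h⁰(X, E ⊗ O(D)) ≥ 1`: there is a nonzero meromorphic section of `E` of order at least `-D(x)`
at every point `x`. -/
def HasSectionTwist (D : X →₀ ℤ) : Prop :=
  ∃ s : ∀ x, E x,
    (∀ x, MeromorphicAt (localRep F E s x) (chartAt ℂ x x) ∧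
      ((-D x : ℤ) : WithTop ℤ) ≤ sectionOrder F E s x) ∧
    ∃ x, sectionOrder F E s x ≠ ⊤

/-- The theta locus `Θ_E = {L ∈ Pic⁰(X) : h⁰(X, E ⊗ L) ≥ 1}`, pulled back along the universal
covering `H⁰(X, K)^* → H⁰(X, K)^* / H₁(X, ℤ) = Pic⁰(X)`.  The covering sends the functional
`∑ ∫_{γ_i}` to the class of `O(∑ (γ_i(1) - γ_i(0)))` (Abel-Jacobi) and `0` to `O_X`. -/
def thetaLocus : Set (Module.Dual ℂ (H0K X)) :=
  {ξ | ∃ (m : ℕ) (γ : Fin m → ℝ → X),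
    (∀ i, ContMDiff 𝓘(ℝ) 𝓘(ℝ, ℂ) 1 (γ i)) ∧
    (∀ α, ξ α = ∑ i, pathIntegral (γ i) α) ∧
    HasSectionTwist F E (boundary γ)}

end Curve

/-- The (affine) tangent cone at `0` of the germ of a set `Z`: the common zeros of the leading forms
of all analytic function germs that vanish on `Z`.  If `n` is the order of `f` at `0`, the `n`-th
derivative of `f` at `0` on the diagonal is `n!` times the leading form `f_n`.  For a hypersurface
with local equation `f` this is the hypersurface `f_n = 0`, leading forms being multiplicative. -/
def tangentCone {W : Type*} [NormedAddCommGroup W] [NormedSpace ℂ W] (Z : Set W) : Set W :=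
  {v | ∀ f : W → ℂ, AnalyticAt ℂ f 0 → (∀ᶠ z in 𝓝[Z] 0, f z = 0) →
    ∀ n : ℕ, (∀ k < n, iteratedFDeriv ℂ k f 0 = 0) → iteratedFDeriv ℂ n f 0 (fun _ => v) = 0}

/-- The linear coordinates on the dual of `V` given by a basis of `V`. -/
def dualCoords {V : Type*} [AddCommGroup V] [Module ℂ V] {g : ℕ} (b : Module.Basis (Fin g) ℂ V)
    (ξ : Module.Dual ℂ V) : Fin g → ℂ := fun j => ξ (b j)

end CurveBundle

end

/-!
Both assertions come down to evaluation of sections at a single point.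

At `ξ = φ_{p,v}` the pairing `(s, t) ↦ ξ(μ̄(s ⊗ t))` is `t_p(s_p)(v)`, so `Λ(φ_{p,v})` factors as
evaluation `H⁰(E) → E_p` followed by `fibrePairing : E_p → H⁰(K ⊗ E^*)^*`.  The first map is onto
because `E` is globally generated, the second is injective because `K ⊗ E^*` is; hence the rank
is `dim E_p = r` (`finrank_range_Lam_canonicalPoint`).

For the tangent cone, vanishing at `p` imposes `r` conditions on the `r + 1`-dimensional space
`H⁰(E)`, so some nonzero section vanishes at `p`.  It is a section of `E ⊗ O(q - p)` for every `q`,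
whence the whole curve `{O(q - p)}` lies in `Θ_E` (`discFunctional_mem_thetaLocus`).  Near `q = p`
this curve lifts to `H⁰(K)^*` as `q ↦ ∫_p^q`, whose derivative at `p` in the direction `v` is
`φ_{p,v}` (`tendsto_inv_mul_pathIntegral`).  Finally, limits of secant directions of a set belong to
its tangent cone (`mem_tangentCone_of_tendsto`).
-/

noncomputable section

namespace CurveBundle

open Filter

/-! ### Secant directions and the tangent cone -/

/-- A limit of secant directions `ε⁻¹ • c` with `c` in `Z` and `ε → 0` lies in the tangent cone: if
`f` has order at least `n` and vanishes on `Z`, then `f_n(ε⁻¹ • c) = ε⁻ⁿ (f_n(c) - f(c))` tends to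
zero. -/
theorem mem_tangentCone_of_tendsto {W ι : Type*} [NormedAddCommGroup W] [NormedSpace ℂ W]
    {Z : Set W} {l : Filter ι} [l.NeBot] {c : ι → W} {ε : ι → ℂ} {w : W}
    (hε : Tendsto ε l (𝓝 0)) (hε0 : ∀ᶠ i in l, ε i ≠ 0) (hc : ∀ᶠ i in l, c i ∈ Z)
    (hw : Tendsto (fun i => (ε i)⁻¹ • c i) l (𝓝 w)) : w ∈ tangentCone Z := by
  intro f hf hfZ n hn
  have hc0 : Tendsto c l (𝓝 0) := by
    have h := hε.smul hw
    rw [zero_smul] at h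
    refine h.congr' ?_
    filter_upwards [hε0] with i hi
    rw [smul_smul, mul_inv_cancel₀ hi, one_smul]
  have hfc : ∀ᶠ i in l, f (c i) = 0 :=
    (tendsto_nhdsWithin_iff.2 ⟨hc0, hc⟩).eventually hfZ
  obtain ⟨q, R, hq⟩ := hf
  have hqk : ∀ k < n, ∀ y : W, q k (fun _ => y) = 0 := by
    intro k hk y
    have h := hq.factorial_smul y k
    rw [hn k hk] at h
    simpa [Nat.factorial_ne_zero] using h
  have hqn := hq.factorial_smul w n
  suffices h : q n (fun _ => w) = 0 by
    rw [← hqn, h, smul_zero]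
  -- The remainder of the Taylor polynomial of degree `n` is `O(‖c‖ ^ (n + 1))`.
  obtain ⟨C, hC⟩ :=
    ((hq.hasFPowerSeriesAt.isBigO_sub_partialSum_pow (n + 1)).comp_tendsto hc0).bound
  have hbound : ∀ᶠ i in l, ‖q n (fun _ => (ε i)⁻¹ • c i)‖ ≤
      C * (‖(ε i)⁻¹ • c i‖ ^ n * ‖c i‖) := by
    filter_upwards [hC, hfc] with i hi hfi
    have hsum : q.partialSum (n + 1) (c i) = q n (fun _ => c i) := by
      rw [FormalMultilinearSeries.partialSum, Finset.sum_range_succ,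
        Finset.sum_eq_zero fun k hk => hqk k (Finset.mem_range.1 hk) _, zero_add]
    simp only [Function.comp_apply, zero_add, hfi, hsum, zero_sub, norm_neg, norm_pow,
      norm_norm] at hi
    rw [ContinuousMultilinearMap.map_smul_univ, Finset.prod_const, Finset.card_univ,
      Fintype.card_fin, norm_smul, norm_pow, norm_smul, mul_pow]
    calc _ ≤ ‖(ε i)⁻¹‖ ^ n * (C * ‖c i‖ ^ (n + 1)) := by gcongr
      _ = _ := by ring
  have hlim : Tendsto (fun i => C * (‖(ε i)⁻¹ • c i‖ ^ n * ‖c i‖)) l (𝓝 0) := by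
    simpa using ((hw.norm.pow n).mul hc0.norm).const_mul C
  have hcont : Tendsto (fun i => q n (fun _ => (ε i)⁻¹ • c i)) l (𝓝 (q n fun _ => w)) :=
    ((q n).cont.tendsto _).comp (tendsto_pi_nhds.2 fun _ => hw)
  exact tendsto_nhds_unique hcont (squeeze_zero_norm' hbound hlim)

/-! ### The pairing at a point -/

section Fibre

variable {X : Type*} [TopologicalSpace X] [ChartedSpace ℂ X]
variable {F : Type*} [NormedAddCommGroup F] [NormedSpace ℂ F]
variable {E : X → Type*} [TopologicalSpace (Bundle.TotalSpace F E)]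
  [∀ x, AddCommGroup (E x)] [∀ x, Module ℂ (E x)] [∀ x, TopologicalSpace (E x)]
  [FiberBundle F E] [VectorBundle ℂ F E]

variable (F E) in
/-- The continuous linear identification of the fibre of `E` at `x` with the model fibre. -/
def fibreEquiv (x : X) : E x ≃L[ℂ] F :=
  (trivializationAt F E x).continuousLinearEquivAt ℂ x
    (FiberBundle.mem_baseSet_trivializationAt F E x)

variable (F E) in
/-- Evaluation of global sections of `E` at a point. -/
def evalAt (x : X) : H0 F E →ₗ[ℂ] E x where
  toFun s := s x
  map_add' _ _ := rfl
  map_smul' _ _ := rfl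

variable [IsManifold 𝓘(ℂ) ω X]

variable (F E) in
/-- The map `E_p → H⁰(X, K ⊗ E^*)^*`, `e ↦ (t ↦ t_p(e)(v))`, induced by a tangent vector `v`
at `p`. -/
def fibrePairing (p : X) (v : TangentSpace 𝓘(ℂ) p) :
    E p →ₗ[ℂ] Module.Dual ℂ (H0SerreDual F E) :=
  LinearMap.mk₂ ℂ (fun (e : E p) (t : H0SerreDual F E) => (t p e v : ℂ))
    (fun e e' t => by rw [map_add]; rfl) (fun c e t => by rw [map_smul]; rfl)
    (fun _ _ _ => rfl) (fun _ _ _ => rfl)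

theorem Lam_canonicalPoint (p : X) (v : TangentSpace 𝓘(ℂ) p) :
    Lam F E (canonicalPoint p v) = (fibrePairing F E p v).comp (evalAt F E p) :=
  rfl

/-- Global generation of `K ⊗ E^*` provides enough sections to separate the vectors of `E_p`. -/
theorem fibrePairing_injective
    (hKE : IsGloballyGenerated (F →L[ℂ] ℂ →L[ℂ] ℂ) (SerreDual E))
    (p : X) {v : TangentSpace 𝓘(ℂ) p} (hv : v ≠ 0) :
    Function.Injective (fibrePairing F E p v) := by
  rw [injective_iff_map_eq_zero]
  intro e he
  by_contra hne
  obtain ⟨l, -, hl⟩ := exists_dual_vector ℂ (fibreEquiv F E p e)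
    (by simpa using hne)
  -- A homomorphism `E_p → K_p` that does not kill `e`, evaluated at `v`.
  let c : ℂ := v
  let κ : Canonical X p := (c⁻¹ • ContinuousLinearMap.id ℂ ℂ : ℂ →L[ℂ] ℂ)
  have hκ : (κ v : ℂ) = 1 := inv_mul_cancel₀ (G₀ := ℂ) hv
  let φ : SerreDual E p :=
    ContinuousLinearMap.smulRight (l.comp (fibreEquiv F E p : E p →L[ℂ] F)) κ
  obtain ⟨t, ht⟩ := hKE p φ
  have h1 : (t p e v : ℂ) = 0 := LinearMap.congr_fun he t
  have h2 : (t p e v : ℂ) = l (fibreEquiv F E p e) * κ v := by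
    change t p = φ at ht
    rw [ht]; rfl
  rw [h1, hκ, mul_one, hl] at h2
  exact hne ((fibreEquiv F E p).map_eq_zero_iff.1
    (norm_eq_zero.1 (RCLike.ofReal_eq_zero.1 h2.symm)))

theorem finrank_range_Lam_canonicalPoint (hE : IsGloballyGenerated F E)
    (hKE : IsGloballyGenerated (F →L[ℂ] ℂ →L[ℂ] ℂ) (SerreDual E))
    (p : X) {v : TangentSpace 𝓘(ℂ) p} (hv : v ≠ 0) :
    Module.finrank ℂ (LinearMap.range (Lam F E (canonicalPoint p v))) = Module.finrank ℂ F := by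
  rw [Lam_canonicalPoint, LinearMap.range_comp_of_range_eq_top _
    (LinearMap.range_eq_top.2 (hE p)),
    LinearMap.finrank_range_of_inj (fibrePairing_injective hKE p hv)]
  exact (fibreEquiv F E p).toLinearEquiv.finrank_eq

end Fibre

/-! ### Twisting by the difference of two points -/

section Analytic

variable {X : Type*} [TopologicalSpace X] [ChartedSpace ℂ X] [IsManifold 𝓘(ℂ) ω X]
variable {F : Type*} [NormedAddCommGroup F] [NormedSpace ℂ F] [FiniteDimensional ℂ F]
variable {E : X → Type*} [TopologicalSpace (Bundle.TotalSpace F E)]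
  [∀ x, TopologicalSpace (E x)] [FiberBundle F E]

theorem analyticAt_localRep (s : H0 F E) (x : X) :
    AnalyticAt ℂ (localRep F E s x) (chartAt ℂ x x) := by
  have : CompleteSpace F := FiniteDimensional.complete ℂ F
  have h := (Bundle.contMDiffAt_section x).1 (s.contMDiff x)
  have hx : (chartAt ℂ x).symm (chartAt ℂ x x) = x :=
    (chartAt ℂ x).left_inv (mem_chart_source ℂ x)
  have hsymm : ContMDiffAt 𝓘(ℂ) 𝓘(ℂ) ω (chartAt ℂ x).symm (chartAt ℂ x x) :=
    contMDiffOn_chart_symm.contMDiffAt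
      ((chartAt ℂ x).open_target.mem_nhds (mem_chart_target ℂ x))
  have := ContMDiffAt.comp_of_eq h hsymm hx
  exact (contMDiffAt_iff_contDiffAt.1 this).analyticAt

end Analytic

section Twist

variable {X : Type*} [TopologicalSpace X] [ChartedSpace ℂ X]
variable {F : Type*} [NormedAddCommGroup F] [NormedSpace ℂ F]
variable {E : X → Type*} [TopologicalSpace (Bundle.TotalSpace F E)]
  [∀ x, AddCommGroup (E x)] [∀ x, Module ℂ (E x)] [∀ x, TopologicalSpace (E x)]
  [FiberBundle F E] [VectorBundle ℂ F E]

/-- If `h⁰(E)` exceeds the rank, vanishing at a point imposes too few conditions to kill all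
sections. -/
theorem exists_section_eq_zero_at [FiniteDimensional ℂ F]
    (h0 : Module.finrank ℂ F < Module.finrank ℂ (H0 F E)) (p : X) :
    ∃ s : H0 F E, s ≠ 0 ∧ s p = 0 := by
  have : FiniteDimensional ℂ (H0 F E) := Module.finite_of_finrank_pos (by omega)
  have hker := LinearMap.ker_ne_bot_of_finrank_lt
    (f := (fibreEquiv F E p).toLinearEquiv.toLinearMap.comp (evalAt F E p)) h0
  obtain ⟨s, hs, hs0⟩ := (Submodule.ne_bot_iff _).1 hker
  exact ⟨s, hs0, (fibreEquiv F E p).map_eq_zero_iff.1 hs⟩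

theorem localRep_chartAt (s : ∀ x, E x) (x : X) :
    localRep F E s x (chartAt ℂ x x) = fibreEquiv F E x (s x) := by
  have h : ∀ y, y = x → (trivializationAt F E x ⟨y, s y⟩).2 = fibreEquiv F E x (s x) := by
    rintro y rfl; rfl
  exact h _ ((chartAt ℂ x).left_inv (mem_chart_source ℂ x))

variable [IsManifold 𝓘(ℂ) ω X] [FiniteDimensional ℂ F]

/-- A nonzero holomorphic section vanishing at `p` has order at least `1` at `p` and at least `0`
elsewhere, so it is a section of `E ⊗ O(q - p)` for every `q`; this includes `q = p`. -/
theorem hasSectionTwist_of_section {s : H0 F E} (hs : s ≠ 0) {p q : X} (hsp : s p = 0) :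
    HasSectionTwist F E (Finsupp.single q 1 - Finsupp.single p 1) := by
  classical
  refine ⟨s, fun x => ⟨(analyticAt_localRep s x).meromorphicAt, ?_⟩, ?_⟩
  · rw [sectionOrder, (analyticAt_localRep s x).meromorphicOrderAt_eq]
    have hD : ((Finsupp.single q 1 - Finsupp.single p 1 : X →₀ ℤ) x) ≥ if p = x then -1 else 0 := by
      simp only [Finsupp.sub_apply, Finsupp.single_apply]
      split_ifs <;> simp
    -- The bound `-D(x) ≤ 1` at `p` and `-D(x) ≤ 0` elsewhere is matched by the order of `s`.
    have hord : (if p = x then 1 else 0 : ℤ) ≤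
        (analyticOrderAt (localRep F E s x) (chartAt ℂ x x)).map (Nat.cast : ℕ → ℤ) := by
      split_ifs with h
      · subst h
        have hne := (analyticAt_localRep s p).analyticOrderAt_ne_zero.2
          (by rw [localRep_chartAt, hsp, map_zero])
        generalize analyticOrderAt (localRep F E s p) (chartAt ℂ p p) = o at hne ⊢
        cases o with
        | top => exact le_top
        | coe m =>
          have : m ≠ 0 := by simpa using hne
          have : (1 : ℤ) ≤ m := by omega
          exact WithTop.coe_le_coe.2 this
      · generalize analyticOrderAt (localRep F E s x) (chartAt ℂ x x) = o
        cases o with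
        | top => exact le_top
        | coe m =>
          have : (0 : ℤ) ≤ m := by omega
          exact WithTop.coe_le_coe.2 this
    refine le_trans ?_ hord
    norm_cast
    split_ifs at hD ⊢ <;> omega
  · obtain ⟨x, hx⟩ : ∃ x, s x ≠ 0 := by
      by_contra! h
      exact hs (ContMDiffSection.ext h)
    -- A holomorphic section has order `0` where its value is nonzero.
    refine ⟨x, ?_⟩
    rw [sectionOrder, (analyticAt_localRep s x).meromorphicOrderAt_eq,
      (analyticAt_localRep s x).analyticOrderAt_eq_zero.2]
    · simp
    · rw [localRep_chartAt]
      simpa using hx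

end Twist

/-! ### Differentials along paths in a chart -/

section Paths

variable {X : Type*} [TopologicalSpace X] [ChartedSpace ℂ X] [IsManifold 𝓘(ℂ) ω X]

variable (X) in
/-- Transition maps that are holomorphic are real `C^1`; the paths of the theta locus are smooth with
respect to the underlying real structure. -/
theorem isManifold_real : IsManifold 𝓘(ℝ, ℂ) 1 X := by
  refine isManifold_of_contDiffOn _ _ _ fun e e' he he' => ?_
  have h := (contDiffGroupoid ω 𝓘(ℂ)).compatible he he'
  rw [contDiffGroupoid, mem_groupoid_of_pregroupoid] at h
  exact (ContDiffOn.restrict_scalars ℝ h.1).of_le le_top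

/-- The coefficient at `z` of the differential `α` with respect to the coordinate of the preferred
chart at `p`: the value of `α` on the coordinate vector field. -/
def chartCoeff (p : X) (α : H0K X) (z : ℂ) : ℂ :=
  α ((chartAt ℂ p).symm z) (mfderiv 𝓘(ℂ) 𝓘(ℂ) (chartAt ℂ p).symm z (1 : ℂ))

theorem mdifferentiableAt_chartAt_symm (p : X) {z : ℂ} (hz : z ∈ (chartAt ℂ p).target) :
    MDifferentiableAt 𝓘(ℂ) 𝓘(ℂ) (chartAt ℂ p).symm z :=
  have : IsManifold 𝓘(ℂ) 1 X := IsManifold.of_le (n := ω) le_top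
  ((contMDiffOn_chart_symm (n := 1)).contMDiffAt
    ((chartAt ℂ p).open_target.mem_nhds hz)).mdifferentiableAt one_ne_zero

theorem chartCoeff_add (p : X) (α β : H0K X) (z : ℂ) :
    chartCoeff p (α + β) z = chartCoeff p α z + chartCoeff p β z :=
  rfl

theorem chartCoeff_smul (p : X) (c : ℂ) (α : H0K X) (z : ℂ) :
    chartCoeff p (c • α) z = c * chartCoeff p α z :=
  rfl

/-- Only continuity is needed: the Abel-Jacobi map is differentiated at a single point. -/
theorem continuousOn_chartCoeff (p : X) (α : H0K X) :
    ContinuousOn (chartCoeff p α) (chartAt ℂ p).target := by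
  have : IsManifold 𝓘(ℂ) 1 X := IsManifold.of_le (n := ω) le_top
  set e := chartAt ℂ p
  intro z hz
  have hsymm : ContMDiffOn 𝓘(ℂ) 𝓘(ℂ) ω e.symm e.target := contMDiffOn_chart_symm
  have hvec : ContMDiffAt 𝓘(ℂ) (𝓘(ℂ).prod 𝓘(ℂ)) 0
      (fun w => (⟨e.symm w, mfderiv 𝓘(ℂ) 𝓘(ℂ) e.symm w (1 : ℂ)⟩ : TangentBundle 𝓘(ℂ) X)) z := by
    have h1 := hsymm.contMDiffOn_tangentMapWithin (m := 0) le_top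
      e.open_target.uniqueMDiffOn
    -- The coordinate vector field is the image of the constant field `1` under the tangent map.
    have h2 : ContMDiff 𝓘(ℂ) 𝓘(ℂ).tangent 0
        (fun w : ℂ => (⟨w, (1 : ℂ)⟩ : TangentBundle 𝓘(ℂ) ℂ)) := fun w =>
      contMDiffAt_vectorSpace_iff_contDiffAt.2 contDiffAt_const
    have h3 := (h1.comp h2.contMDiffOn (s := e.target) (fun w hw => hw)).contMDiffAt
      (e.open_target.mem_nhds hz)
    refine h3.congr_of_eventuallyEq ?_
    filter_upwards [e.open_target.mem_nhds hz] with w hw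
    simp only [Function.comp_apply, tangentMapWithin]
    rw [mfderivWithin_of_mem_nhds (e.open_target.mem_nhds hw)]
  have hα : ContMDiffAt 𝓘(ℂ) (𝓘(ℂ).prod 𝓘(ℂ, ℂ →L[ℂ] ℂ)) 0
      (fun w => (⟨e.symm w, α (e.symm w)⟩ : Bundle.TotalSpace (ℂ →L[ℂ] ℂ) (Canonical X))) z :=
    ((α.contMDiff.of_le (zero_le)).contMDiffAt).comp z
      ((hsymm.contMDiffAt (e.open_target.mem_nhds hz)).of_le (zero_le))
  have h := ContMDiffAt.clm_bundle_apply hα hvec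
  exact (Bundle.contMDiffAt_totalSpace.1 h).2.continuousAt.continuousWithinAt

/-- At `p` itself the coordinate vector field is `1 : T_p X = ℂ`, because the tangent space at `p` is
identified with `ℂ` through the preferred chart at `p`. -/
theorem chartCoeff_chartAt_mul (p : X) (α : H0K X) (v : ℂ) :
    chartCoeff p α (chartAt ℂ p p) * v = canonicalPoint p v α := by
  have hz := mem_chart_target ℂ p
  have hp : (chartAt ℂ p).symm (chartAt ℂ p p) = p :=
    (chartAt ℂ p).left_inv (mem_chart_source ℂ p)
  let D : ℂ →L[ℂ] ℂ := mfderiv 𝓘(ℂ) 𝓘(ℂ) (chartAt ℂ p).symm (chartAt ℂ p p)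
  let g : ℂ → ℂ :=
    writtenInExtChartAt 𝓘(ℂ) 𝓘(ℂ) (chartAt ℂ p p) (chartAt ℂ p).symm
  -- In the preferred chart at `p` the inverse of that chart is the identity.
  have hD : D = ContinuousLinearMap.id ℂ ℂ := by
    have h : HasFDerivWithinAt g D (Set.range id) (chartAt ℂ p p) :=
      (mdifferentiableAt_chartAt_symm p hz).hasMFDerivAt.2
    rw [Set.range_id, hasFDerivWithinAt_univ] at h
    have hid : id =ᶠ[𝓝 (chartAt ℂ p p)] g := by
      filter_upwards [(chartAt ℂ p).open_target.mem_nhds hz] with w hw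
      change w = chartAt ℂ ((chartAt ℂ p).symm (chartAt ℂ p p)) ((chartAt ℂ p).symm w)
      rw [hp, (chartAt ℂ p).right_inv hw]
    exact (h.congr_of_eventuallyEq hid).unique (hasFDerivAt_id _)
  let A : X → ℂ →L[ℂ] ℂ := fun x => α x
  change A ((chartAt ℂ p).symm (chartAt ℂ p p)) (D 1) * v = A p v
  rw [hD, hp, ContinuousLinearMap.id_apply, mul_comm, ← smul_eq_mul, ← map_smul, smul_eq_mul,
    mul_one]

/-- A path running inside the preferred chart at `p`, given by its coordinate `u`. -/
def chartPath (p : X) (u : ℝ → ℂ) (t : ℝ) : X := (chartAt ℂ p).symm (u t)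

theorem contMDiff_chartPath (p : X) {u : ℝ → ℂ} (hu : ContDiff ℝ 1 u)
    (hmem : ∀ t, u t ∈ (chartAt ℂ p).target) : ContMDiff 𝓘(ℝ) 𝓘(ℝ, ℂ) 1 (chartPath p u) := by
  have := isManifold_real X
  intro t
  exact ((contMDiffOn_chart_symm (I := 𝓘(ℝ, ℂ)) (n := 1)).contMDiffAt
    ((chartAt ℂ p).open_target.mem_nhds (hmem t))).comp t hu.contMDiff.contMDiffAt

/-- The chain rule for a path in a chart, moving between the real derivative that defines `velocity`
and the complex derivative of the chart. -/
theorem apply_velocity_chartPath (p : X) {u : ℝ → ℂ} {t : ℝ} {u' : ℂ} (hu : HasDerivAt u u' t)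
    (ht : u t ∈ (chartAt ℂ p).target) (α : H0K X) :
    (α (chartPath p u t) (velocity (chartPath p u) t) : ℂ) = chartCoeff p α (u t) * u' := by
  have h1 := (mdifferentiableAt_chartAt_symm p ht).hasMFDerivAt
  set D : ℂ →L[ℂ] ℂ := mfderiv 𝓘(ℂ) 𝓘(ℂ) (chartAt ℂ p).symm (u t) with hD
  have h2 : HasMFDerivAt 𝓘(ℝ, ℂ) 𝓘(ℝ, ℂ) (chartAt ℂ p).symm (u t) (D.restrictScalars ℝ) :=
    ⟨h1.1, HasFDerivWithinAt.restrictScalars ℝ h1.2⟩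
  have h3 : HasMFDerivAt 𝓘(ℝ) 𝓘(ℝ, ℂ) (chartPath p u) t _ :=
    h2.comp t hu.hasFDerivAt.hasMFDerivAt
  have h4 : (velocity (chartPath p u) t : ℂ) = D u' := by
    rw [velocity, h3.mfderiv]
    change D ((1 : ℝ) • u') = D u'
    rw [one_smul]
  have h5 : D u' = u' * D 1 := by
    rw [← smul_eq_mul, ← map_smul, smul_eq_mul, mul_one]
  let A : ℂ →L[ℂ] ℂ := α (chartPath p u t)
  change A (velocity (chartPath p u) t : ℂ) = A (D 1) * u'
  rw [h4, h5, ← smul_eq_mul, map_smul, smul_eq_mul, mul_comm]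

end Paths

/-! ### Short paths in a disc -/

/-- The coordinate of a smooth path from the point with coordinate `z` to the point with coordinate
`z + w`. The reparametrization by the sine keeps it in the disc of radius `‖w‖` about `z` for all
times, as paths are required to be defined and smooth on the whole real line. -/
def discPath (z w : ℂ) (t : ℝ) : ℂ := z + (Real.sin (Real.pi / 2 * t) : ℂ) * w

theorem hasDerivAt_sin_half_pi (t : ℝ) :
    HasDerivAt (fun t : ℝ => Real.sin (Real.pi / 2 * t))
      (Real.pi / 2 * Real.cos (Real.pi / 2 * t)) t := by
  have h := ((hasDerivAt_id t).const_mul (Real.pi / 2)).sin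
  simpa [mul_comm] using h

theorem hasDerivAt_discPath (z w : ℂ) (t : ℝ) :
    HasDerivAt (discPath z w) (((Real.pi / 2 * Real.cos (Real.pi / 2 * t) : ℝ) : ℂ) * w) t :=
  ((hasDerivAt_sin_half_pi t).ofReal_comp.mul_const w).const_add z

theorem contDiff_discPath (z w : ℂ) : ContDiff ℝ 1 (discPath z w) := by
  refine contDiff_const.add (ContDiff.mul ?_ contDiff_const)
  exact Complex.ofRealCLM.contDiff.comp (Real.contDiff_sin.comp (contDiff_const.mul contDiff_id))

theorem norm_discPath_sub_le (z w : ℂ) (t : ℝ) : ‖discPath z w t - z‖ ≤ ‖w‖ := by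
  rw [discPath, add_sub_cancel_left, norm_mul, Complex.norm_real]
  exact mul_le_of_le_one_left (norm_nonneg _) (Real.abs_sin_le_one _)

@[simp] theorem discPath_zero (z w : ℂ) : discPath z w 0 = z := by simp [discPath]

theorem eventually_discPath_mem {z : ℂ} (v : ℂ) {U : Set ℂ} (hU : U ∈ 𝓝 z) :
    ∀ᶠ ε : ℂ in 𝓝[≠] 0, ∀ t, discPath z (ε * v) t ∈ U := by
  obtain ⟨δ, hδ, hball⟩ := Metric.mem_nhds_iff.1 hU
  have hlim : Tendsto (fun ε : ℂ => ‖ε * v‖) (𝓝[≠] 0) (𝓝 0) := by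
    have h : Continuous fun ε : ℂ => ‖ε * v‖ := by fun_prop
    simpa using (h.tendsto 0).mono_left nhdsWithin_le_nhds
  filter_upwards [hlim.eventually_lt_const hδ] with ε hε t
  exact hball (mem_ball_iff_norm.2 ((norm_discPath_sub_le _ _ t).trans_lt hε))

/-! ### The Abel-Jacobi image of a short path -/

section Theta

variable {X : Type*} [TopologicalSpace X] [ChartedSpace ℂ X] [IsManifold 𝓘(ℂ) ω X]

theorem pathIntegral_discPath (p : X) {w : ℂ}
    (hmem : ∀ t, discPath (chartAt ℂ p p) w t ∈ (chartAt ℂ p).target) (α : H0K X) :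
    pathIntegral (chartPath p (discPath (chartAt ℂ p p) w)) α =
      ∫ t in (0 : ℝ)..1, chartCoeff p α (discPath (chartAt ℂ p p) w t) *
        (((Real.pi / 2 * Real.cos (Real.pi / 2 * t) : ℝ) : ℂ) * w) :=
  intervalIntegral.integral_congr fun t _ =>
    apply_velocity_chartPath p (hasDerivAt_discPath _ w t) (hmem t) α

theorem continuous_integrand (p : X) {w : ℂ}
    (hmem : ∀ t, discPath (chartAt ℂ p p) w t ∈ (chartAt ℂ p).target) (α : H0K X) :
    Continuous fun t : ℝ => chartCoeff p α (discPath (chartAt ℂ p p) w t) *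
        (((Real.pi / 2 * Real.cos (Real.pi / 2 * t) : ℝ) : ℂ) * w) :=
  ((continuousOn_chartCoeff p α).comp_continuous (contDiff_discPath _ w).continuous hmem).mul
    (by fun_prop)

/-- Integration of holomorphic differentials along the path `discPath` in the chart at `p`, as a
functional: an Abel-Jacobi lift of the divisor given by the end points. -/
def discFunctional (p : X) {w : ℂ}
    (hmem : ∀ t, discPath (chartAt ℂ p p) w t ∈ (chartAt ℂ p).target) :
    Module.Dual ℂ (H0K X) where
  toFun α := pathIntegral (chartPath p (discPath (chartAt ℂ p p) w)) α
  map_add' α β := by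
    simp only [pathIntegral_discPath p hmem, chartCoeff_add, add_mul]
    exact intervalIntegral.integral_add ((continuous_integrand p hmem α).intervalIntegrable _ _)
      ((continuous_integrand p hmem β).intervalIntegrable _ _)
  map_smul' c α := by
    simp only [pathIntegral_discPath p hmem, chartCoeff_smul, mul_assoc, RingHom.id_apply,
      smul_eq_mul]
    exact intervalIntegral.integral_const_mul _ _

/-- The integral along a short path differs from the linear term by at most the oscillation of the
coefficient times the length bound `π / 2 * ‖w‖`. -/
theorem norm_pathIntegral_discPath_sub_le (p : X) {w : ℂ}
    (hmem : ∀ t, discPath (chartAt ℂ p p) w t ∈ (chartAt ℂ p).target) (α : H0K X) {η : ℝ}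
    (hη : ∀ t, ‖chartCoeff p α (discPath (chartAt ℂ p p) w t) -
      chartCoeff p α (chartAt ℂ p p)‖ ≤ η) :
    ‖pathIntegral (chartPath p (discPath (chartAt ℂ p p) w)) α - canonicalPoint p w α‖ ≤
      η * (Real.pi / 2 * ‖w‖) := by
  set z := chartAt ℂ p p
  -- The constant part of the integrand integrates to the value at the base point.
  have hconst : ∫ t in (0 : ℝ)..1, chartCoeff p α z *
      (((Real.pi / 2 * Real.cos (Real.pi / 2 * t) : ℝ) : ℂ) * w) = canonicalPoint p w α := by
    rw [intervalIntegral.integral_const_mul,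
      intervalIntegral.integral_eq_sub_of_hasDerivAt (fun t _ => hasDerivAt_discPath z w t)
        (Continuous.intervalIntegrable (by fun_prop) _ _), ← chartCoeff_chartAt_mul]
    simp [discPath, z]
  rw [pathIntegral_discPath p hmem, ← hconst, ← intervalIntegral.integral_sub
    ((continuous_integrand p hmem α).intervalIntegrable _ _)
    (Continuous.intervalIntegrable (by fun_prop) _ _)]
  refine (intervalIntegral.norm_integral_le_of_norm_le_const fun t _ => ?_).trans
    (by rw [sub_zero, abs_one, mul_one])
  rw [← sub_mul, norm_mul, norm_mul, Complex.norm_real, norm_mul,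
    Real.norm_of_nonneg Real.pi_div_two_pos.le]
  have hcos := Real.abs_cos_le_one (Real.pi / 2 * t)
  have hη0 : 0 ≤ η := (norm_nonneg _).trans (hη t)
  refine mul_le_mul (hη t) ?_ (by positivity) hη0
  refine mul_le_mul_of_nonneg_right ?_ (norm_nonneg _)
  exact mul_le_of_le_one_right Real.pi_div_two_pos.le hcos

/-- The first-order behaviour of the Abel-Jacobi map at `p`: its derivative in the direction `v` is
the point `φ_{p,v}` of the canonical cone. -/
theorem tendsto_inv_mul_pathIntegral (p : X) (v : ℂ) (α : H0K X) :
    Tendsto (fun ε : ℂ => ε⁻¹ *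
        pathIntegral (chartPath p (discPath (chartAt ℂ p p) (ε * v))) α)
      (𝓝[≠] 0) (𝓝 (canonicalPoint p v α)) := by
  have htarget := (chartAt ℂ p).open_target.mem_nhds (mem_chart_target ℂ p)
  have hcont : ContinuousAt (chartCoeff p α) (chartAt ℂ p p) :=
    (continuousOn_chartCoeff p α).continuousAt htarget
  rw [Metric.tendsto_nhds]
  intro η hη
  -- Adding `1` keeps `C` positive when `v = 0` and makes the final estimate strict.
  set C : ℝ := Real.pi / 2 * ‖v‖ + 1
  have hC : 0 < C := by have := Real.pi_pos; positivity
  have hball := hcont (Metric.closedBall_mem_nhds _ (div_pos hη hC))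
  filter_upwards [eventually_discPath_mem v htarget, eventually_discPath_mem v hball,
    self_mem_nhdsWithin] with ε hmem hnear (hε : ε ≠ 0)
  have hle := norm_pathIntegral_discPath_sub_le p hmem α (η := η / C) fun t => by
    simpa [dist_eq_norm] using hnear t
  have hlin : canonicalPoint p (ε * v : ℂ) α = ε * canonicalPoint p v α := by
    rw [← chartCoeff_chartAt_mul, ← chartCoeff_chartAt_mul]; ring
  have hpos : 0 < ‖ε‖ := norm_pos_iff.2 hε
  rw [hlin] at hle
  rw [dist_eq_norm]
  calc _ = ‖ε‖⁻¹ * ‖pathIntegral (chartPath p (discPath (chartAt ℂ p p) (ε * v))) α -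
        ε * canonicalPoint p v α‖ := by
        rw [← norm_inv, ← norm_mul, mul_sub, inv_mul_cancel_left₀ hε]
    _ ≤ ‖ε‖⁻¹ * (η / C * (Real.pi / 2 * ‖ε * v‖)) := by gcongr
    _ = η / C * (Real.pi / 2 * ‖v‖) := by rw [norm_mul]; field_simp
    _ < η / C * C := by
        have := div_pos hη hC
        gcongr
        exact lt_add_one _
    _ = η := div_mul_cancel₀ _ hC.ne'

/-! ### The canonical curve and the theta locus -/

variable {F : Type*} [NormedAddCommGroup F] [NormedSpace ℂ F] [FiniteDimensional ℂ F]
variable {E : X → Type*} [TopologicalSpace (Bundle.TotalSpace F E)]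
  [∀ x, AddCommGroup (E x)] [∀ x, Module ℂ (E x)] [∀ x, TopologicalSpace (E x)]
  [FiberBundle F E] [VectorBundle ℂ F E]

/-- The line bundle `O(q - p)` lies in `Θ_E` because a nonzero section of `E` vanishing at `p` is a
section of `E ⊗ O(q - p)`. -/
theorem discFunctional_mem_thetaLocus
    (h0 : Module.finrank ℂ F < Module.finrank ℂ (H0 F E)) (p : X) {w : ℂ}
    (hmem : ∀ t, discPath (chartAt ℂ p p) w t ∈ (chartAt ℂ p).target) :
    discFunctional p hmem ∈ thetaLocus F E := by
  obtain ⟨s, hs, hsp⟩ := exists_section_eq_zero_at h0 p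
  refine ⟨1, fun _ => chartPath p (discPath (chartAt ℂ p p) w),
    fun _ => contMDiff_chartPath p (contDiff_discPath _ w) hmem,
    fun α => by rw [Fin.sum_univ_one]; rfl, ?_⟩
  have hp : chartPath p (discPath (chartAt ℂ p p) w) 0 = p := by
    rw [chartPath, discPath_zero, (chartAt ℂ p).left_inv (mem_chart_source ℂ p)]
  rw [boundary, Fin.sum_univ_one, hp]
  exact hasSectionTwist_of_section hs hsp

/-- The functionals of short paths from `p` in the direction `v` lie in `Θ_E`, and their secant
directions converge to `φ_{p,v}`. -/
theorem canonicalPoint_mem_tangentCone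
    (h0 : Module.finrank ℂ F < Module.finrank ℂ (H0 F E)) {g : ℕ}
    (b : Module.Basis (Fin g) ℂ (H0K X)) (p : X) (v : TangentSpace 𝓘(ℂ) p) :
    dualCoords b (canonicalPoint p v) ∈ tangentCone (dualCoords b '' thetaLocus F E) := by
  have htarget := (chartAt ℂ p).open_target.mem_nhds (mem_chart_target ℂ p)
  have hε : Tendsto (fun ε : ℂ => ε) (𝓝[≠] 0) (𝓝 0) := nhdsWithin_le_nhds
  let c : ℂ := v
  refine mem_tangentCone_of_tendsto hε self_mem_nhdsWithin
    (c := fun ε j => pathIntegral (chartPath p (discPath (chartAt ℂ p p) (ε * c))) (b j)) ?_ ?_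
  · filter_upwards [eventually_discPath_mem c htarget] with ε hmem
    exact ⟨discFunctional p hmem, discFunctional_mem_thetaLocus h0 p hmem, rfl⟩
  · exact tendsto_pi_nhds.2 fun j => tendsto_inv_mul_pathIntegral p c (b j)

end Theta

end CurveBundle

end

theorem mainTheorem9
    {X : Type*} [TopologicalSpace X] [T2Space X] [CompactSpace X] [ConnectedSpace X]
    [ChartedSpace ℂ X] [IsManifold 𝓘(ℂ) ω X]
    {F : Type*} [NormedAddCommGroup F] [NormedSpace ℂ F] [FiniteDimensional ℂ F]
    {E : X → Type*} [TopologicalSpace (Bundle.TotalSpace F E)]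
    [∀ x, AddCommGroup (E x)] [∀ x, Module ℂ (E x)] [∀ x, TopologicalSpace (E x)]
    [FiberBundle F E] [VectorBundle ℂ F E] [ContMDiffVectorBundle ω F E 𝓘(ℂ)]
    (r : ℕ) (hr : Module.finrank ℂ F = r)
    (h0 : Module.finrank ℂ (CurveBundle.H0 F E) = r + 1)
    (hE : CurveBundle.IsGloballyGenerated F E)
    (hKE : CurveBundle.IsGloballyGenerated (F →L[ℂ] ℂ →L[ℂ] ℂ) (CurveBundle.SerreDual E)) :
    (∀ (p : X) (v : TangentSpace 𝓘(ℂ) p), v ≠ 0 →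
      Module.finrank ℂ (LinearMap.range
        (CurveBundle.Lam F E (CurveBundle.canonicalPoint p v))) = r) ∧
    (∀ (g : ℕ) (b : Module.Basis (Fin g) ℂ (CurveBundle.H0K X))
      (p : X) (v : TangentSpace 𝓘(ℂ) p), v ≠ 0 →
      CurveBundle.dualCoords b (CurveBundle.canonicalPoint p v) ∈
        CurveBundle.tangentCone
          (CurveBundle.dualCoords b '' CurveBundle.thetaLocus F E)) := by
  constructor
  · intro p v hv
    rw [CurveBundle.finrank_range_Lam_canonicalPoint hE hKE p hv, hr]
  · intro g b p v _
    exact CurveBundle.canonicalPoint_mem_tangentCone (by omega) b p v
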